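/- **Theorem (Disjunction Property).** Let $\mathsf{IKP}$ be finitary intuitionistic Kripke–Platek set theory, i.e. the theory in intuitionistic first-order logic with equality, in the language with the single binary relation symbol $\in$, whose axioms are - extensionality: $\forall x\forall y(\forall z(z\in x\leftrightarrow z\in y)\to x=y)$; - empty set: $\exists x\forall y\,(y\notin x)$; - pairing: $\forall x\forall y\exists z\forall w\,(w\in z\leftrightarrow (w=x\vee w=y))$; - union: $\forall x\exists y\forall w\,(w\in y\leftrightarrow\exists z(w\in z\wedge z\in x))$; - infinity: $\exists x\,\bigl(\emptyset\in x\wedge\forall y\,(y\in x\to y\cup\{y\}\in x)\wedge\forall y\,(y\in x\to (y=\emptyset\vee\exists z\in y\; y=z\cup\{z\}))\bigr)$; - induction: $\forall\mathbf p\,\bigl(\forall x\,((\forall z\in x\,\varphi(z,\mathbf p))\to\varphi(x,\mathbf p))\to\forall x\,\varphi(x,\mathbf p)\bigr)$ for every formula $\varphi$; - $\Delta_0$-separation: $\forall\mathbf p\,\forall w\exists z\forall w'\,(w'\in z\leftrightarrow (w'\in w\wedge\varphi(w',\mathbf p)))$ for every $\Delta_0$-formula $\varphi$; - $\Delta_0$-collection: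 $\forall\mathbf p\,\bigl(\forall x\exists y\,\varphi(x,y,\mathbf p)\to\forall w\exists w'\,\forall x\in w\,\exists y\in w'\,\varphi(x,y,\mathbf p)\bigr)$ for every $\Delta_0$-formula $\varphi$, where a formula is $\Delta_0$ if all its quantifiers are bounded, i.e. of the form $\forall x\in y$ or $\exists x\in y$. Then $\mathsf{IKP}$ has the disjunction property: for all sentences $\varphi,\psi$ of the language of set theory, if $\mathsf{IKP}\vdash\varphi\vee\psi$, then $\mathsf{IKP}\vdash\varphi$ or $\mathsf{IKP}\vdash\psi$. -/

import Mathlib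

/-- Formulas of the finitary first-order language of set theory (`∈` and `=`, no function or
constant symbols) whose free variables are among `n` given ones, in de Bruijn style: variables are
elements of `Fin n`, and under a quantifier `0` is the variable that has just been bound while the
outer variable `i` becomes `i.succ`. All intuitionistic connectives and both quantifiers are
primitive. -/
inductive SetFormula : ℕ → Type
  | falsum {n : ℕ} : SetFormula n
  | mem {n : ℕ} (i j : Fin n) : SetFormula n
  | eq {n : ℕ} (i j : Fin n) : SetFormula n
  | imp {n : ℕ} (φ ψ : SetFormula n) : SetFormula n
  | conj {n : ℕ} (φ ψ : SetFormula n) : SetFormula n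
  | disj {n : ℕ} (φ ψ : SetFormula n) : SetFormula n
  | all {n : ℕ} (φ : SetFormula (n + 1)) : SetFormula n
  | ex {n : ℕ} (φ : SetFormula (n + 1)) : SetFormula n

/-- Sentences: formulas without free variables. -/
abbrev SetSentence : Type := SetFormula 0

namespace SetFormula

/-- `¬ φ` is `φ → ⊥`. -/
def neg {n : ℕ} (φ : SetFormula n) : SetFormula n := imp φ falsum

/-- `(φ → ψ) ∧ (ψ → φ)`. -/
def iff {n : ℕ} (φ ψ : SetFormula n) : SetFormula n := conj (imp φ ψ) (imp ψ φ)

/-- Bounded universal quantification `∀ x ∈ i, φ`, that is `∀ x (x ∈ i → φ)`. -/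
def ballIn {n : ℕ} (i : Fin n) (φ : SetFormula (n + 1)) : SetFormula n :=
  all (imp (mem 0 i.succ) φ)

/-- Bounded existential quantification `∃ x ∈ i, φ`, that is `∃ x (x ∈ i ∧ φ)`. -/
def bexIn {n : ℕ} (i : Fin n) (φ : SetFormula (n + 1)) : SetFormula n :=
  ex (conj (mem 0 i.succ) φ)

/-- The extension of a map of variables under one quantifier. -/
def liftVar {m n : ℕ} (f : Fin m → Fin n) : Fin (m + 1) → Fin (n + 1) :=
  Fin.cases 0 (fun i => (f i).succ)

/-- Simultaneous (capture-avoiding) substitution of variables for variables. -/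
def rename : {m n : ℕ} → (Fin m → Fin n) → SetFormula m → SetFormula n
  | _, _, _, falsum => falsum
  | _, _, f, mem i j => mem (f i) (f j)
  | _, _, f, eq i j => eq (f i) (f j)
  | _, _, f, imp φ ψ => imp (rename f φ) (rename f ψ)
  | _, _, f, conj φ ψ => conj (rename f φ) (rename f ψ)
  | _, _, f, disj φ ψ => disj (rename f φ) (rename f ψ)
  | _, _, f, all φ => all (rename (liftVar f) φ)
  | _, _, f, ex φ => ex (rename (liftVar f) φ)

/-- Weakening: `φ` read in a context with one more variable `0`, which does not occur in it. -/
def weaken {n : ℕ} (φ : SetFormula n) : SetFormula (n + 1) := rename Fin.succ φ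

/-- `φ[i/x]`, where `x` is the variable `0` of `φ`. -/
def inst {n : ℕ} (φ : SetFormula (n + 1)) (i : Fin n) : SetFormula n :=
  rename (Fin.cases i id) φ

/-- A sentence read as a formula in any context. -/
def ofSentence (n : ℕ) (σ : SetSentence) : SetFormula n := rename (fun i => i.elim0) σ

/-- The universal closure. -/
def univClosure : {n : ℕ} → SetFormula n → SetSentence
  | 0, φ => φ
  | _ + 1, φ => univClosure (all φ)

/-- `Δ₀`-formulas: those all of whose quantifiers are bounded. -/
inductive IsDelta0 : {n : ℕ} → SetFormula n → Prop
  | falsum {n : ℕ} : IsDelta0 (falsum : SetFormula n)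
  | mem {n : ℕ} (i j : Fin n) : IsDelta0 (mem i j)
  | eq {n : ℕ} (i j : Fin n) : IsDelta0 (eq i j)
  | imp {n : ℕ} {φ ψ : SetFormula n} : IsDelta0 φ → IsDelta0 ψ → IsDelta0 (imp φ ψ)
  | conj {n : ℕ} {φ ψ : SetFormula n} : IsDelta0 φ → IsDelta0 ψ → IsDelta0 (conj φ ψ)
  | disj {n : ℕ} {φ ψ : SetFormula n} : IsDelta0 φ → IsDelta0 ψ → IsDelta0 (disj φ ψ)
  | ballIn {n : ℕ} (i : Fin n) {φ : SetFormula (n + 1)} : IsDelta0 φ → IsDelta0 (ballIn i φ)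
  | bexIn {n : ℕ} (i : Fin n) {φ : SetFormula (n + 1)} : IsDelta0 φ → IsDelta0 (bexIn i φ)

/-- `i = ∅`, that is `∀ u, u ∉ i`. -/
def isEmpty {n : ℕ} (i : Fin n) : SetFormula n := all (neg (mem 0 i.succ))

/-- `j = i ∪ {i}`, that is `∀ u (u ∈ j ↔ u ∈ i ∨ u = i)`. -/
def isSucc {n : ℕ} (i j : Fin n) : SetFormula n :=
  all (iff (mem 0 j.succ) (disj (mem 0 i.succ) (eq 0 i.succ)))

end SetFormula

open SetFormula in
/-- Derivability `T; Γ ⊢ φ` in intuitionistic first-order logic with equality (natural deduction,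
formulas in context), for a set `T` of sentences as axioms and a finite list `Γ` of open
assumptions. -/
inductive IntDerives (T : Set SetSentence) :
    {n : ℕ} → List (SetFormula n) → SetFormula n → Prop
  | ax {n : ℕ} {Γ : List (SetFormula n)} {σ : SetSentence} :
      σ ∈ T → IntDerives T Γ (ofSentence n σ)
  | hyp {n : ℕ} {Γ : List (SetFormula n)} {φ : SetFormula n} :
      φ ∈ Γ → IntDerives T Γ φ
  | falsumE {n : ℕ} {Γ : List (SetFormula n)} {φ : SetFormula n} :
      IntDerives T Γ falsum → IntDerives T Γ φ
  | andI {n : ℕ} {Γ : List (SetFormula n)} {φ ψ : SetFormula n} :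
      IntDerives T Γ φ → IntDerives T Γ ψ → IntDerives T Γ (conj φ ψ)
  | andE₁ {n : ℕ} {Γ : List (SetFormula n)} {φ ψ : SetFormula n} :
      IntDerives T Γ (conj φ ψ) → IntDerives T Γ φ
  | andE₂ {n : ℕ} {Γ : List (SetFormula n)} {φ ψ : SetFormula n} :
      IntDerives T Γ (conj φ ψ) → IntDerives T Γ ψ
  | orI₁ {n : ℕ} {Γ : List (SetFormula n)} {φ ψ : SetFormula n} :
      IntDerives T Γ φ → IntDerives T Γ (disj φ ψ)
  | orI₂ {n : ℕ} {Γ : List (SetFormula n)} {φ ψ : SetFormula n} :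
      IntDerives T Γ ψ → IntDerives T Γ (disj φ ψ)
  | orE {n : ℕ} {Γ : List (SetFormula n)} {φ ψ χ : SetFormula n} :
      IntDerives T Γ (disj φ ψ) → IntDerives T (φ :: Γ) χ → IntDerives T (ψ :: Γ) χ →
        IntDerives T Γ χ
  | impI {n : ℕ} {Γ : List (SetFormula n)} {φ ψ : SetFormula n} :
      IntDerives T (φ :: Γ) ψ → IntDerives T Γ (imp φ ψ)
  | impE {n : ℕ} {Γ : List (SetFormula n)} {φ ψ : SetFormula n} :
      IntDerives T Γ (imp φ ψ) → IntDerives T Γ φ → IntDerives T Γ ψ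
  | allI {n : ℕ} {Γ : List (SetFormula n)} {φ : SetFormula (n + 1)} :
      IntDerives T (Γ.map weaken) φ → IntDerives T Γ (all φ)
  | allE {n : ℕ} {Γ : List (SetFormula n)} {φ : SetFormula (n + 1)} (i : Fin n) :
      IntDerives T Γ (all φ) → IntDerives T Γ (inst φ i)
  | exI {n : ℕ} {Γ : List (SetFormula n)} {φ : SetFormula (n + 1)} (i : Fin n) :
      IntDerives T Γ (inst φ i) → IntDerives T Γ (ex φ)
  | exE {n : ℕ} {Γ : List (SetFormula n)} {φ : SetFormula (n + 1)} {χ : SetFormula n} :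
      IntDerives T Γ (ex φ) → IntDerives T (φ :: Γ.map weaken) (weaken χ) → IntDerives T Γ χ
  | eqRefl {n : ℕ} {Γ : List (SetFormula n)} (i : Fin n) : IntDerives T Γ (eq i i)
  | eqSubst {n : ℕ} {Γ : List (SetFormula n)} (φ : SetFormula (n + 1)) {i j : Fin n} :
      IntDerives T Γ (eq i j) → IntDerives T Γ (inst φ i) → IntDerives T Γ (inst φ j)

/-- `T ⊢ φ` for a set `T` of sentences and a sentence `φ`. -/
def IntProvable (T : Set SetSentence) (φ : SetSentence) : Prop := IntDerives T [] φ

namespace IKP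

open SetFormula

/-- `∀x ∀y (∀z (z ∈ x ↔ z ∈ y) → x = y)`. -/
def extensionality : SetSentence :=
  all (all (imp (all (iff (mem 0 2) (mem 0 1))) (eq 1 0)))

/-- `∃x ∀y (y ∉ x)`. -/
def emptySet : SetSentence := ex (all (neg (mem 0 1)))

/-- `∀x ∀y ∃z ∀w (w ∈ z ↔ w = x ∨ w = y)`. -/
def pairing : SetSentence :=
  all (all (ex (all (iff (mem 0 1) (disj (eq 0 3) (eq 0 2))))))

/-- `∀x ∃y ∀w (w ∈ y ↔ ∃z (w ∈ z ∧ z ∈ x))`. -/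
def union : SetSentence :=
  all (ex (all (iff (mem 0 1) (ex (conj (mem 1 0) (mem 0 3))))))

/-- `∃x (∅ ∈ x ∧ ∀y (y ∈ x → y ∪ {y} ∈ x) ∧ ∀y (y ∈ x → y = ∅ ∨ ∃z ∈ y, y = z ∪ {z}))`. -/
def infinity : SetSentence :=
  ex (conj (bexIn 0 (isEmpty 0))
    (conj (ballIn 0 (bexIn 1 (isSucc 1 0)))
      (ballIn 0 (disj (isEmpty 0) (bexIn 0 (isSucc 0 1))))))

/-- For `φ(x, p)` with `x` the variable `0` and parameters `p`:
`∀p (∀x ((∀z ∈ x, φ(z, p)) → φ(x, p)) → ∀x φ(x, p))`. -/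
def induction {n : ℕ} (φ : SetFormula (n + 1)) : SetSentence :=
  univClosure (imp (all (imp (ballIn 0 (rename (liftVar Fin.succ) φ)) φ)) (all φ))

/-- For `φ(x, p)` with `x` the variable `0` and parameters `p`:
`∀p ∀w ∃z ∀w' (w' ∈ z ↔ w' ∈ w ∧ φ(w', p))`. -/
def separation {n : ℕ} (φ : SetFormula (n + 1)) : SetSentence :=
  univClosure (all (ex (all (iff (mem 0 1)
    (conj (mem 0 2) (rename (liftVar (fun i => i.succ.succ)) φ))))))

/-- For `φ(x, y, p)` with `x` the variable `1`, `y` the variable `0` and parameters `p`: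
`∀p (∀x ∃y φ(x, y, p) → ∀w ∃w' ∀x ∈ w ∃y ∈ w' φ(x, y, p))`. -/
def collection {n : ℕ} (φ : SetFormula (n + 2)) : SetSentence :=
  univClosure (imp (all (ex φ))
    (all (ex (ballIn 1 (bexIn 1 (rename (liftVar (liftVar (fun i => i.succ.succ))) φ))))))

/-- The axioms of (finitary) intuitionistic Kripke-Platek set theory with infinity. -/
inductive IsAxiom : SetSentence → Prop
  | extensionality : IsAxiom extensionality
  | emptySet : IsAxiom emptySet
  | pairing : IsAxiom pairing
  | union : IsAxiom union
  | infinity : IsAxiom infinity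
  | induction {n : ℕ} (φ : SetFormula (n + 1)) : IsAxiom (induction φ)
  | separation {n : ℕ} (φ : SetFormula (n + 1)) : IsDelta0 φ → IsAxiom (separation φ)
  | collection {n : ℕ} (φ : SetFormula (n + 2)) : IsDelta0 φ → IsAxiom (collection φ)

/-- The theory `IKP`. -/
def theory : Set SetSentence := {σ | IsAxiom σ}

end IKP

/-! The proof is a slash (realizability-by-truth) argument. A `Name` is a constant of a theory `M`
extending IKP, paired with a countable family of names; entries not provably elements are ignored.
`Slash` evaluates formulas over the names, where an implication or a universal statement must be
both true and provable in `M`. A disjunction is slashed only if one side is, and `Slash.holds` shows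
that everything slashed is provable in `M`. So it suffices that theorems of IKP are slashed
(`slash_of_derives`, `slash_of_isAxiom`) and that `M` proves no new sentences.

To slash an existential axiom, one needs a constant that provably has the required property and
provably contains the values of the intended elements. For most axioms a Henkin witness suffices.
Collection is the obstacle: the true witnesses form a countable family of names, while a finitary
theory gives one collecting set that need not contain them. Any finitely many constants can be added
to a collecting set by pairing and union, because the property is monotone in that set
(`exists_superset`, `holds_collectingFormula_of_subset`). Saturation of `M` then handles countably
many at once (`exists_collecting`).

Such an `M` is obtained in two conservative steps: a Henkin extension of IKP (`Henkin.theory`), then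
its reduced power modulo the cofinite filter. The second step is saturated by a diagonal argument
(`isSaturated_reducedPower`). No disjunction property of `M` is needed, so neither step uses prime
theories or ultrafilters. -/

namespace SetFormula

/-! ### Renaming calculus and countability of formulas. -/

/-- An assignment extended by a value for the variable `0`. -/
def extend {α : Type*} {n : ℕ} (x : α) (v : Fin n → α) : Fin (n + 1) → α := Fin.cases x v

@[simp] theorem extend_zero {α : Type*} {n : ℕ} (x : α) (v : Fin n → α) : extend x v 0 = x := rfl

@[simp] theorem extend_succ {α : Type*} {n : ℕ} (x : α) (v : Fin n → α) (i : Fin n) :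
    extend x v i.succ = v i := rfl

theorem comp_extend {α β : Type*} {n : ℕ} (g : α → β) (x : α) (v : Fin n → α) :
    g ∘ extend x v = extend (g x) (g ∘ v) := by
  funext i; cases i using Fin.cases <;> rfl

theorem extend_comp_succ {α : Type*} {n : ℕ} (x : α) (v : Fin n → α) :
    extend x v ∘ Fin.succ = v := rfl

theorem extend_comp_liftVar {α : Type*} {m n : ℕ} (x : α) (v : Fin n → α) (f : Fin m → Fin n) :
    extend x v ∘ liftVar f = extend x (v ∘ f) := by
  funext i; cases i using Fin.cases <;> rfl

theorem liftVar_comp {l m n : ℕ} (g : Fin m → Fin n) (f : Fin l → Fin m) :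
    liftVar g ∘ liftVar f = liftVar (g ∘ f) := by
  funext i; cases i using Fin.cases <;> rfl

theorem liftVar_id {n : ℕ} : liftVar (id : Fin n → Fin n) = id := by
  funext i; cases i using Fin.cases <;> rfl

theorem rename_id {n : ℕ} (φ : SetFormula n) : rename id φ = φ := by
  induction φ <;> simp_all [rename, liftVar_id]

theorem rename_rename {l m n : ℕ} (g : Fin m → Fin n) (f : Fin l → Fin m) (φ : SetFormula l) :
    rename g (rename f φ) = rename (g ∘ f) φ := by
  induction φ generalizing m n <;> simp_all [rename, liftVar_comp]

theorem rename_weaken {m n : ℕ} (f : Fin m → Fin n) (φ : SetFormula m) :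
    rename (liftVar f) (weaken φ) = weaken (rename f φ) := by
  simp only [weaken, rename_rename]; rfl

theorem rename_inst {m n : ℕ} (f : Fin m → Fin n) (φ : SetFormula (m + 1)) (i : Fin m) :
    rename f (inst φ i) = inst (rename (liftVar f) φ) (f i) := by
  simp only [inst, rename_rename]
  congr 1; funext j; cases j using Fin.cases <;> rfl

theorem rename_ofSentence {m n : ℕ} (f : Fin m → Fin n) (σ : SetSentence) :
    rename f (ofSentence m σ) = ofSentence n σ := by
  simp only [ofSentence, rename_rename]
  congr 1; funext j; exact j.elim0

theorem ofSentence_zero (σ : SetSentence) : ofSentence 0 σ = σ := by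
  have : (fun i : Fin 0 => (i.elim0 : Fin 0)) = id := by funext j; exact j.elim0
  rw [ofSentence, this, rename_id]

theorem inst_rename_liftVar_succ {n : ℕ} (φ : SetFormula (n + 1)) :
    inst (rename (liftVar Fin.succ) φ) 0 = φ := by
  rw [inst, rename_rename]
  convert rename_id φ
  funext j; cases j using Fin.cases <;> rfl

/-- An injective numbering of the formulas in a given context. -/
def code : {n : ℕ} → SetFormula n → ℕ
  | _, falsum => Nat.pair 0 0
  | _, mem i j => Nat.pair 1 (Nat.pair i j)
  | _, eq i j => Nat.pair 2 (Nat.pair i j)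
  | _, imp φ ψ => Nat.pair 3 (Nat.pair (code φ) (code ψ))
  | _, conj φ ψ => Nat.pair 4 (Nat.pair (code φ) (code ψ))
  | _, disj φ ψ => Nat.pair 5 (Nat.pair (code φ) (code ψ))
  | _, all φ => Nat.pair 6 (code φ)
  | _, ex φ => Nat.pair 7 (code φ)

theorem code_injective {n : ℕ} : Function.Injective (code : SetFormula n → ℕ) := by
  intro φ
  induction φ with
  | imp φ ψ h₁ h₂ =>
    intro χ h; cases χ <;> simp [code, Nat.pair_eq_pair] at h
    rw [h₁ h.1, h₂ h.2]
  | conj φ ψ h₁ h₂ =>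
    intro χ h; cases χ <;> simp [code, Nat.pair_eq_pair] at h
    rw [h₁ h.1, h₂ h.2]
  | disj φ ψ h₁ h₂ =>
    intro χ h; cases χ <;> simp [code, Nat.pair_eq_pair] at h
    rw [h₁ h.1, h₂ h.2]
  | all φ h₁ =>
    intro χ h; cases χ <;> simp [code, Nat.pair_eq_pair] at h
    rw [h₁ h]
  | ex φ h₁ =>
    intro χ h; cases χ <;> simp [code, Nat.pair_eq_pair] at h
    rw [h₁ h]
  | falsum => intro χ h; cases χ <;> simp [code, Nat.pair_eq_pair] at h; rfl
  | mem i j =>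
    intro χ h; cases χ <;> simp [code, Nat.pair_eq_pair, Fin.val_inj] at h
    rw [h.1, h.2]
  | eq i j =>
    intro χ h; cases χ <;> simp [code, Nat.pair_eq_pair, Fin.val_inj] at h
    rw [h.1, h.2]

instance {n : ℕ} : Countable (SetFormula n) := code_injective.countable

end SetFormula

/-! ### Structural rules of derivability. -/

namespace IntDerives

open SetFormula

variable {T : Set SetSentence}

/-- Renaming of variables and weakening of the assumptions. -/
theorem rename_mono {m : ℕ} {Δ : List (SetFormula m)} {φ : SetFormula m} (h : IntDerives T Δ φ) :
    ∀ {n : ℕ} (f : Fin m → Fin n) {Γ : List (SetFormula n)}, (∀ δ ∈ Δ, rename f δ ∈ Γ) →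
      IntDerives T Γ (rename f φ) := by
  have cons {m n : ℕ} {Δ : List (SetFormula m)} {Γ : List (SetFormula n)} {f : Fin m → Fin n}
      (φ : SetFormula m) (hΓ : ∀ δ ∈ Δ, rename f δ ∈ Γ) :
      ∀ δ ∈ φ :: Δ, rename f δ ∈ rename f φ :: Γ := by
    intro δ hδ
    rcases List.mem_cons.1 hδ with rfl | hδ
    · exact List.mem_cons_self
    · exact List.mem_cons_of_mem _ (hΓ δ hδ)
  have lift {m n : ℕ} {Δ : List (SetFormula m)} {Γ : List (SetFormula n)} {f : Fin m → Fin n}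
      (hΓ : ∀ δ ∈ Δ, rename f δ ∈ Γ) :
      ∀ δ ∈ Δ.map weaken, rename (liftVar f) δ ∈ Γ.map weaken := by
    intro δ hδ
    obtain ⟨γ, hγ, rfl⟩ := List.mem_map.1 hδ
    rw [rename_weaken]
    exact List.mem_map_of_mem (hΓ γ hγ)
  induction h with
  | ax hσ => intro n f Γ _; rw [rename_ofSentence]; exact ax hσ
  | hyp hφ => intro n f Γ hΓ; exact hyp (hΓ _ hφ)
  | falsumE _ ih => intro n f Γ hΓ; exact falsumE (ih f hΓ)
  | andI _ _ ih₁ ih₂ => intro n f Γ hΓ; exact andI (ih₁ f hΓ) (ih₂ f hΓ)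
  | andE₁ _ ih => intro n f Γ hΓ; exact andE₁ (ih f hΓ)
  | andE₂ _ ih => intro n f Γ hΓ; exact andE₂ (ih f hΓ)
  | orI₁ _ ih => intro n f Γ hΓ; exact orI₁ (ih f hΓ)
  | orI₂ _ ih => intro n f Γ hΓ; exact orI₂ (ih f hΓ)
  | orE _ _ _ ih ih₁ ih₂ =>
    intro n f Γ hΓ; exact orE (ih f hΓ) (ih₁ f (cons _ hΓ)) (ih₂ f (cons _ hΓ))
  | impI _ ih => intro n f Γ hΓ; exact impI (ih f (cons _ hΓ))
  | impE _ _ ih₁ ih₂ => intro n f Γ hΓ; exact impE (ih₁ f hΓ) (ih₂ f hΓ)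
  | allI _ ih => intro n f Γ hΓ; exact allI (ih (liftVar f) (lift hΓ))
  | allE i _ ih => intro n f Γ hΓ; rw [rename_inst]; exact allE _ (ih f hΓ)
  | exI i _ ih =>
    intro n f Γ hΓ
    exact exI (f i) (by rw [← rename_inst]; exact ih f hΓ)
  | exE _ _ ih₁ ih₂ =>
    intro n f Γ hΓ
    refine exE (ih₁ f hΓ) ?_
    rw [← rename_weaken]
    exact ih₂ (liftVar f) (cons _ (lift hΓ))
  | eqRefl i => intro n f Γ _; exact eqRefl _
  | eqSubst φ _ _ ih₁ ih₂ =>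
    intro n f Γ hΓ
    rw [rename_inst]
    exact eqSubst _ (ih₁ f hΓ) (by rw [← rename_inst]; exact ih₂ f hΓ)

theorem mono {n : ℕ} {Δ Γ : List (SetFormula n)} {φ : SetFormula n} (h : IntDerives T Δ φ)
    (hΓ : ∀ δ ∈ Δ, δ ∈ Γ) : IntDerives T Γ φ := by
  simpa only [rename_id] using h.rename_mono id (Γ := Γ) (by simpa only [rename_id] using hΓ)

theorem cut {n : ℕ} {Γ : List (SetFormula n)} : ∀ {Δ : List (SetFormula n)} {φ : SetFormula n},
    IntDerives T Δ φ → (∀ δ ∈ Δ, IntDerives T Γ δ) → IntDerives T Γ φ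
  | [], _, h, _ => h.mono (by simp)
  | δ :: Δ, _, h, hΓ =>
    impE (cut (impI h) fun γ hγ => hΓ γ (List.mem_cons_of_mem _ hγ)) (hΓ δ List.mem_cons_self)

/-- Renaming of variables followed by a cut. -/
theorem subst {m n : ℕ} {Δ : List (SetFormula m)} {φ : SetFormula m} (h : IntDerives T Δ φ)
    (f : Fin m → Fin n) {Γ : List (SetFormula n)} (hΓ : ∀ δ ∈ Δ, IntDerives T Γ (rename f δ)) :
    IntDerives T Γ (rename f φ) :=
  cut (h.rename_mono f (Γ := Δ.map (rename f)) fun _ hδ => List.mem_map_of_mem hδ) (by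
    simpa using hΓ)

end IntDerives

/-! ### Henkin extensions. -/

open SetFormula

/-- A deductively closed theory over `T` in the language with a constant for every element of `C`,
in which all existential theorems have witnesses. -/
structure HenkinTheory (T : Set SetSentence) where
  C : Type
  Holds : ∀ {m : ℕ}, SetFormula m → (Fin m → C) → Prop
  holds_rename : ∀ {m n : ℕ} (g : Fin m → Fin n) (φ : SetFormula m) (f : Fin n → C),
    Holds (rename g φ) f ↔ Holds φ (f ∘ g)
  holds_of_derives : ∀ {m : ℕ} {Δ : List (SetFormula m)} {φ : SetFormula m}, IntDerives T Δ φ →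
    ∀ f : Fin m → C, (∀ δ ∈ Δ, Holds δ f) → Holds φ f
  witness : ∀ {m : ℕ} (φ : SetFormula (m + 1)) (f : Fin m → C), Holds (ex φ) f →
    ∃ c, Holds φ (extend c f)

namespace Henkin

/-- The tasks of the Henkin construction: existential formulas with parameters. -/
abbrev Task : Type := Σ m : ℕ, SetFormula (m + 1) × (Fin m → ℕ)

/-- Recurrence is needed because an existential formula may become derivable only late, and its
parameters must already have been introduced when it is treated. -/
theorem exists_schedule : ∃ task : ℕ → Task, ∀ t N, ∃ i, N ≤ i ∧ task i = t := by
  have : Nonempty (Task × ℕ) := ⟨⟨0, eq 0 0, Fin.elim0⟩, 0⟩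
  obtain ⟨e, he⟩ := exists_surjective_nat (Task × ℕ)
  refine ⟨fun i => (e i).1, fun t N => ?_⟩
  have hinj : Set.InjOn (Function.surjInv he) Set.univ := (Function.injective_surjInv he).injOn
  have hinf : (Set.range fun k : ℕ => Function.surjInv he (t, k)).Infinite :=
    Set.infinite_range_of_injective fun a b hab => by
      simpa using Function.injective_surjInv he hab
  obtain ⟨i, ⟨k, rfl⟩, hi⟩ := hinf.exists_gt N
  exact ⟨_, hi.le, by simp [Function.surjInv_eq he]⟩

/-- A schedule that takes up every task infinitely often. -/
noncomputable def task : ℕ → Task := Classical.choose exists_schedule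

theorem exists_task (t : Task) (N : ℕ) : ∃ i, N ≤ i ∧ task i = t :=
  Classical.choose_spec exists_schedule t N

/-- The variable for the `k`-th Henkin constant at stage `i`, for `k ≤ i`. -/
def var (i k : ℕ) : Fin (i + 1) := ⟨i - k, by omega⟩

theorem var_succ {i k : ℕ} (h : k ≤ i) : var (i + 1) k = (var i k).succ := by
  ext; simp [var]; omega

theorem var_self (i : ℕ) : var i i = 0 := by
  ext; simp [var]

variable (T : Set SetSentence)

/-- The formula which task `t` asks a new constant to satisfy at stage `i`. -/
def request (i : ℕ) (t : Task) : SetFormula (i + 2) :=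
  rename (liftVar (var i ∘ t.2.2)) t.2.1

open Classical in
/-- The assumption on the constant that is added to the assumptions `Γ` of stage `i`. -/
noncomputable def newAssumption (i : ℕ) (Γ : List (SetFormula (i + 1))) : SetFormula (i + 2) :=
  if IntDerives T Γ (ex (request i (task i))) then request i (task i) else eq 0 0

/-- The assumptions of the stages of the Henkin construction. -/
noncomputable def stage : (i : ℕ) → List (SetFormula (i + 1))
  | 0 => []
  | i + 1 => newAssumption T i (stage i) :: (stage i).map weaken

variable {T}

/-- This is what makes each stage conservative. Adding the unconditional Henkin axiom `∃x φ → φ(c)`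
would not do, since `∃c (∃x φ → φ(c))` is not intuitionistically valid; hence the case distinction
with the harmless default `eq 0 0`. -/
theorem derives_ex_newAssumption (i : ℕ) :
    IntDerives T (stage T i) (ex (newAssumption T i (stage T i))) := by
  unfold newAssumption
  split_ifs with h
  · exact h
  · exact .exI 0 (.eqRefl _)

theorem derives_weaken_stage {i : ℕ} {φ : SetFormula (i + 1)} (h : IntDerives T (stage T i) φ) :
    IntDerives T (stage T (i + 1)) (weaken φ) :=
  h.rename_mono Fin.succ fun _ hδ => List.mem_cons_of_mem _ (List.mem_map_of_mem hδ)

/-- A sentence that is derivable at some stage is derivable at the initial stage. -/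
theorem derives_stage_zero {σ : SetSentence} :
    ∀ {i : ℕ}, IntDerives T (stage T i) (ofSentence _ σ) → IntDerives T [] (ofSentence 1 σ)
  | 0, h => h
  | i + 1, h => derives_stage_zero (.exE (derives_ex_newAssumption i) (by
      rwa [weaken, rename_ofSentence]))

/-- Derivability of `φ`, with the Henkin constants `f` as parameters, at almost all stages. -/
def Holds {m : ℕ} (φ : SetFormula m) (f : Fin m → ℕ) : Prop :=
  ∀ᶠ i in Filter.atTop, IntDerives T (stage T i) (rename (var i ∘ f) φ)

theorem derives_stage_mono {m : ℕ} {φ : SetFormula m} {f : Fin m → ℕ} {i : ℕ}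
    (hf : ∀ j, f j ≤ i) (h : IntDerives T (stage T i) (rename (var i ∘ f) φ)) :
    ∀ k, i ≤ k → IntDerives T (stage T k) (rename (var k ∘ f) φ) := by
  intro k hk
  induction k, hk using Nat.le_induction with
  | base => exact h
  | succ k hk ih =>
    have := derives_weaken_stage ih
    rw [weaken, rename_rename] at this
    convert this using 2
    funext j
    exact var_succ ((hf j).trans hk)

theorem holds_of_derives_stage {m : ℕ} {φ : SetFormula m} {f : Fin m → ℕ} {i : ℕ}
    (hf : ∀ j, f j ≤ i) (h : IntDerives T (stage T i) (rename (var i ∘ f) φ)) :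
    Holds (T := T) φ f :=
  Filter.eventually_atTop.2 ⟨i, derives_stage_mono hf h⟩

theorem holds_witness {m : ℕ} (φ : SetFormula (m + 1)) (f : Fin m → ℕ)
    (h : Holds (T := T) (ex φ) f) : ∃ c, Holds (T := T) φ (extend c f) := by
  obtain ⟨N, hN⟩ := Filter.eventually_atTop.1 h
  -- The stage is late enough for the existential formula to be derivable and for all its parameters
  -- to exist; the constant introduced next, `i + 1`, is the witness.
  obtain ⟨i, hi, hti⟩ := exists_task ⟨m, φ, f⟩ (max N (Finset.univ.sup f))
  have hf : ∀ j, f j ≤ i := fun j =>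
    (Finset.le_sup (Finset.mem_univ j)).trans ((le_max_right _ _).trans hi)
  have hd : IntDerives T (stage T i) (ex (request i (task i))) := by
    rw [hti]; exact hN i ((le_max_left _ _).trans hi)
  refine ⟨i + 1, holds_of_derives_stage (i := i + 1) ?_ ?_⟩
  · intro j
    cases j using Fin.cases with
    | zero => exact le_rfl
    | succ j => exact (hf j).trans (Nat.le_succ i)
  · have hr : newAssumption T i (stage T i) = request i (task i) := if_pos hd
    have hv : var (i + 1) ∘ extend (i + 1) f = liftVar (var i ∘ f) := by
      funext j
      cases j using Fin.cases with
      | zero => exact var_self _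
      | succ j => exact var_succ (hf j)
    rw [hv]
    apply IntDerives.hyp
    rw [stage, hr, hti]
    exact List.mem_cons_self

variable (T) in
/-- The theory obtained from `T` by adding Henkin constants. -/
def theory : HenkinTheory T where
  C := ℕ
  Holds φ f := Holds (T := T) φ f
  holds_rename g φ f := by simp only [Holds, rename_rename]; rfl
  holds_of_derives {m Δ φ} h f hΔ := by
    have : ∀ᶠ i in Filter.atTop, ∀ δ ∈ Δ, IntDerives T (stage T i) (rename (var i ∘ f) δ) :=
      (Filter.eventually_all_finite Δ.finite_toSet).2 hΔ
    filter_upwards [this] with i hi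
    exact h.subst _ hi
  witness := holds_witness

/-- The Henkin extension is conservative if `T` proves that something exists. -/
theorem provable_of_holds {θ : SetFormula 1} (hθ : IntDerives T [] (ex θ)) {σ : SetSentence}
    {f : Fin 0 → ℕ} (h : (theory T).Holds σ f) : IntProvable T σ := by
  obtain ⟨i, hi⟩ := Filter.Eventually.exists (f := Filter.atTop) h
  have : rename (var i ∘ f) σ = ofSentence _ σ := by
    rw [ofSentence]; congr 1; funext j; exact j.elim0
  rw [this] at hi
  have hσ : weaken σ = ofSentence 1 σ := by
    rw [weaken, ofSentence]; congr 1; funext j; exact j.elim0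
  -- Constant `0` carries no assumption but is still a free variable; the theorem `ex θ` allows it
  -- to be discharged.
  exact .exE hθ ((hσ ▸ derives_stage_zero hi : IntDerives T [] (weaken σ)).mono (by simp))

end Henkin

/-! ### Reduced powers and saturation. -/

namespace HenkinTheory

variable {T : Set SetSentence}

/-- At coordinate `i`, satisfy the strongest condition of index at most `i` that is satisfiable
there. Each fixed `n` is eventually below `i` and satisfiable, so by monotonicity it is eventually
met. -/
theorem exists_diagonal {C : Type} [Nonempty C] (P : ℕ → ℕ → C → Prop)
    (hP : ∀ {k n i c}, k ≤ n → P n i c → P k i c)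
    (h : ∀ n, ∀ᶠ i in Filter.atTop, ∃ c, P n i c) :
    ∃ c : ℕ → C, ∀ n, ∀ᶠ i in Filter.atTop, P n i (c i) := by
  classical
  have (i : ℕ) : ∃ c, ∀ n ≤ i, (∃ d, P n i d) → P n i c := by
    by_cases h0 : ∃ n ≤ i, ∃ d, P n i d
    · obtain ⟨n, hn, hd⟩ := h0
      obtain ⟨c, hc⟩ := Nat.findGreatest_spec (P := fun n => ∃ d, P n i d) hn hd
      exact ⟨c, fun k hk hkd => hP (Nat.le_findGreatest hk hkd) hc⟩
    · exact ⟨Classical.arbitrary C, fun n hn hd => (h0 ⟨n, hn, hd⟩).elim⟩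
  choose c hc using this
  exact ⟨c, fun n => by
    filter_upwards [h n, Filter.eventually_ge_atTop n] with i hi hn using hc i n hn hi⟩

/-- The reduced power of a theory modulo the cofinite filter on `ℕ`. -/
def reducedPower (M : HenkinTheory T) : HenkinTheory T where
  C := ℕ → M.C
  Holds φ f := ∀ᶠ i in Filter.atTop, M.Holds φ fun j => f j i
  holds_rename g φ f := by simp only [M.holds_rename]; rfl
  holds_of_derives {m Δ φ} h f hΔ := by
    have : ∀ᶠ i in Filter.atTop, ∀ δ ∈ Δ, M.Holds δ fun j => f j i :=
      (Filter.eventually_all_finite Δ.finite_toSet).2 hΔ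
    filter_upwards [this] with i hi
    exact M.holds_of_derives h _ hi
  witness {m} φ f h := by
    have hC : Nonempty M.C := by
      obtain ⟨i, hi⟩ := h.exists
      exact ⟨(M.witness _ _ hi).choose⟩
    -- With a condition independent of the index, the diagonal lemma amounts to choosing a witness
    -- at almost every coordinate.
    obtain ⟨c, hc⟩ := exists_diagonal (fun _ i c => M.Holds φ (extend c fun j => f j i))
      (fun _ h => h) fun _ => h.mono fun i hi => M.witness _ _ hi
    refine ⟨c, (hc 0).mono fun i hi => ?_⟩
    convert hi using 1
    exact comp_extend (fun g : ℕ → M.C => g i) c f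

/-- `a ∈ b` holds. -/
def HoldsMem (M : HenkinTheory T) (a b : M.C) : Prop :=
  M.Holds (mem 0 1) (extend a (extend b Fin.elim0))

/-- `a = b` holds. -/
def HoldsEq (M : HenkinTheory T) (a b : M.C) : Prop :=
  M.Holds (eq 0 1) (extend a (extend b Fin.elim0))

/-- Realization of those types which consist of one formula and countably many formulas
`b k ∈ x`. -/
def IsSaturated (M : HenkinTheory T) : Prop :=
  ∀ {m : ℕ} (φ : SetFormula (m + 1)) (f : Fin m → M.C) (b : ℕ → M.C),
    (∀ n, ∃ c, M.Holds φ (extend c f) ∧ ∀ k < n, M.HoldsMem (b k) c) →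
      ∃ c, M.Holds φ (extend c f) ∧ ∀ k, M.HoldsMem (b k) c

/-- A finite part of the type is realized at almost all coordinates, because the cofinite filter is
closed under finite intersections. Diagonalizing over the finite parts gives one sequence realizing
them all. -/
theorem isSaturated_reducedPower (M : HenkinTheory T) : M.reducedPower.IsSaturated := by
  intro m φ f b h
  have e1 (c : ℕ → M.C) (i : ℕ) : (fun j => extend c f j i) = extend (c i) fun j => f j i :=
    comp_extend (fun g : ℕ → M.C => g i) c f
  have e2 (k : ℕ) (c : ℕ → M.C) : M.reducedPower.HoldsMem (b k) c ↔
      ∀ᶠ i in Filter.atTop, M.HoldsMem (b k i) (c i) := by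
    refine Filter.eventually_congr (.of_forall fun i => ?_)
    rw [HoldsMem]
    have : (fun j => extend (b k) (extend c Fin.elim0) j i) =
        extend (b k i) (extend (c i) Fin.elim0) := by
      funext j; fin_cases j <;> rfl
    rw [this]
  have h' (n : ℕ) : ∃ c : ℕ → M.C,
      (∀ᶠ i in Filter.atTop, M.Holds φ (extend (c i) fun j => f j i)) ∧
      ∀ k < n, ∀ᶠ i in Filter.atTop, M.HoldsMem (b k i) (c i) := by
    obtain ⟨c, hc, hb⟩ := h n
    exact ⟨c, hc.mono fun i hi => (congrArg (M.Holds φ) (e1 c i)).mp hi,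
      fun k hk => (e2 k c).1 (hb k hk)⟩
  have hC : Nonempty M.C := ⟨b 0 0⟩
  obtain ⟨c, hc⟩ := exists_diagonal
    (fun n i c => M.Holds φ (extend c fun j => f j i) ∧ ∀ k < n, M.HoldsMem (b k i) c)
    (fun hkn h => ⟨h.1, fun l hl => h.2 l (hl.trans_le hkn)⟩) (by
      intro n
      obtain ⟨c, hc, hb⟩ := h' n
      have : ∀ᶠ i in Filter.atTop, ∀ k ∈ Set.Iio n, M.HoldsMem (b k i) (c i) :=
        (Filter.eventually_all_finite (Set.finite_Iio n)).2 hb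
      filter_upwards [hc, this] with i h1 h2 using ⟨c i, h1, h2⟩)
  exact ⟨c, (hc 0).mono fun i h => (congrArg (M.Holds φ) (e1 c i)).mpr h.1,
    -- The `n`-th condition covers only `k < n`, hence the index `k + 1`.
    fun k => (e2 k c).2 ((hc (k + 1)).mono fun _ h => h.2 k k.lt_succ_self)⟩

end HenkinTheory

/-! ### Names and the slash. -/

namespace HenkinTheory

variable {T : Set SetSentence} {M : HenkinTheory T}

theorem Holds.mp {m : ℕ} {φ ψ : SetFormula m} {f : Fin m → M.C} (h : M.Holds (imp φ ψ) f)
    (hφ : M.Holds φ f) : M.Holds ψ f :=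
  M.holds_of_derives (Δ := [imp φ ψ, φ]) (.impE (.hyp (by simp)) (.hyp (φ := φ) (by simp))) f
    (by simp [h, hφ])

theorem Holds.conj {m : ℕ} {φ ψ : SetFormula m} {f : Fin m → M.C} (h₁ : M.Holds φ f)
    (h₂ : M.Holds ψ f) : M.Holds (conj φ ψ) f :=
  M.holds_of_derives (Δ := [φ, ψ]) (.andI (.hyp (by simp)) (.hyp (by simp))) f
    (by simp [h₁, h₂])

theorem Holds.left {m : ℕ} {φ ψ : SetFormula m} {f : Fin m → M.C}
    (h : M.Holds (SetFormula.conj φ ψ) f) : M.Holds φ f :=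
  M.holds_of_derives (Δ := [SetFormula.conj φ ψ]) (.andE₁ (ψ := ψ) (.hyp (by simp))) f
    (by simp [h])

theorem Holds.right {m : ℕ} {φ ψ : SetFormula m} {f : Fin m → M.C}
    (h : M.Holds (SetFormula.conj φ ψ) f) : M.Holds ψ f :=
  M.holds_of_derives (Δ := [SetFormula.conj φ ψ]) (.andE₂ (φ := φ) (.hyp (by simp))) f
    (by simp [h])

theorem Holds.inl {m : ℕ} {φ : SetFormula m} (ψ : SetFormula m) {f : Fin m → M.C}
    (h : M.Holds φ f) : M.Holds (disj φ ψ) f :=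
  M.holds_of_derives (Δ := [φ]) (.orI₁ (.hyp (by simp))) f (by simp [h])

theorem Holds.inr {m : ℕ} (φ : SetFormula m) {ψ : SetFormula m} {f : Fin m → M.C}
    (h : M.Holds ψ f) : M.Holds (disj φ ψ) f :=
  M.holds_of_derives (Δ := [ψ]) (.orI₂ (.hyp (by simp))) f (by simp [h])

theorem Holds.all {m : ℕ} {φ : SetFormula (m + 1)} {f : Fin m → M.C}
    (h : M.Holds (all φ) f) (c : M.C) : M.Holds φ (extend c f) := by
  refine M.holds_of_derives (Δ := [weaken (SetFormula.all φ)]) ?_ _ ?_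
  · have : IntDerives T [weaken (SetFormula.all φ)] (inst (rename (liftVar Fin.succ) φ) 0) :=
      .allE 0 (.hyp (by simp [weaken, rename]))
    rwa [inst_rename_liftVar_succ] at this
  · simpa [weaken, M.holds_rename, extend_comp_succ] using h

theorem Holds.ex {m : ℕ} {φ : SetFormula (m + 1)} {f : Fin m → M.C} {c : M.C}
    (h : M.Holds φ (extend c f)) : M.Holds (ex φ) f := by
  have : M.Holds (weaken (SetFormula.ex φ)) (extend c f) := by
    refine M.holds_of_derives (Δ := [φ]) (.exI 0 ?_) _ (by simpa using h)
    rw [inst_rename_liftVar_succ]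
    exact .hyp (by simp)
  simpa [weaken, M.holds_rename, extend_comp_succ] using this

theorem Holds.iff {m : ℕ} {φ ψ : SetFormula m} {f : Fin m → M.C} (h : M.Holds (iff φ ψ) f) :
    M.Holds φ f ↔ M.Holds ψ f :=
  ⟨h.left.mp, h.right.mp⟩

theorem holds_mem {m : ℕ} {i j : Fin m} {f : Fin m → M.C} :
    M.Holds (mem i j) f ↔ M.HoldsMem (f i) (f j) := by
  have := M.holds_rename (extend i (extend j Fin.elim0)) (mem 0 1) f
  rw [comp_extend, comp_extend, Subsingleton.elim (f ∘ Fin.elim0) Fin.elim0] at this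
  exact this

theorem holds_eq {m : ℕ} {i j : Fin m} {f : Fin m → M.C} :
    M.Holds (eq i j) f ↔ M.HoldsEq (f i) (f j) := by
  have := M.holds_rename (extend i (extend j Fin.elim0)) (eq 0 1) f
  rw [comp_extend, comp_extend, Subsingleton.elim (f ∘ Fin.elim0) Fin.elim0] at this
  exact this

theorem HoldsEq.refl (a : M.C) : M.HoldsEq a a :=
  holds_eq.1 (M.holds_of_derives (Δ := []) (.eqRefl 0) (extend a Fin.elim0) (by simp))

theorem HoldsEq.subst {a b : M.C} (h : M.HoldsEq a b) {m : ℕ} (φ : SetFormula (m + 1))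
    {f : Fin m → M.C} (ha : M.Holds φ (extend a f)) : M.Holds φ (extend b f) := by
  let s (i : Fin (m + 2)) : Fin (m + 1) → Fin (m + 2) := extend i (Fin.succ ∘ Fin.succ)
  have hs (i : Fin (m + 2)) :
      inst (rename (liftVar (Fin.succ ∘ Fin.succ)) φ) i = rename (s i) φ := by
    rw [inst, rename_rename]; congr 1; exact extend_comp_liftVar i id _
  have hd : IntDerives T [eq 0 1, rename (s 0) φ] (rename (s 1) φ) := by
    rw [← hs, ← hs]
    exact .eqSubst _ (.hyp (φ := eq 0 1) (by simp)) (.hyp (by simp))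
  have := M.holds_of_derives hd (extend a (extend b f)) (by
    intro δ hδ
    simp only [List.mem_cons, List.not_mem_nil, or_false] at hδ
    rcases hδ with rfl | rfl
    · exact holds_eq.2 h
    · rw [M.holds_rename, comp_extend]; exact ha)
  rw [M.holds_rename, comp_extend] at this
  exact this

theorem HoldsEq.symm {a b : M.C} (h : M.HoldsEq a b) : M.HoldsEq b a :=
  h.subst (eq 0 1) (HoldsEq.refl a)

theorem HoldsEq.trans {a b c : M.C} (h : M.HoldsEq a b) (h' : M.HoldsEq b c) : M.HoldsEq a c :=
  holds_eq.1 (h'.subst (eq 1 0) (f := extend a Fin.elim0) (holds_eq.2 h))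

theorem HoldsEq.mem_left {a b c : M.C} (h : M.HoldsEq a b) (hm : M.HoldsMem a c) :
    M.HoldsMem b c :=
  h.subst (mem 0 1) hm

theorem HoldsEq.mem_right {a b c : M.C} (h : M.HoldsEq a b) (hm : M.HoldsMem c a) :
    M.HoldsMem c b :=
  holds_mem.1 (h.subst (mem 1 0) (f := extend c Fin.elim0) (holds_mem.2 hm))

/-- Substitution of equals for one variable in an arbitrary position. -/
theorem HoldsEq.update {a b : M.C} (h : M.HoldsEq a b) {m : ℕ} {φ : SetFormula m}
    {f : Fin m → M.C} {i : Fin m} (ha : M.Holds φ (Function.update f i a)) :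
    M.Holds φ (Function.update f i b) := by
  -- Renaming variable `i` to a fresh variable `0` reduces the claim to substitution for variable
  -- `0`.
  have key (c : M.C) :
      M.Holds (rename (Function.update Fin.succ i 0) φ) (extend c f) ↔
        M.Holds φ (Function.update f i c) := by
    rw [M.holds_rename, Function.comp_update]; rfl
  rw [← key] at ha ⊢
  exact h.subst _ ha

/-- Names for hereditarily countable sets over `M`: a constant `val`, together with a countable
family of names. -/
inductive Name (M : HenkinTheory T) : Type 1
  | mk (val : M.C) (idx : Type) (hidx : Countable idx) (elt : idx → Name M) : Name M

namespace Name

def val : M.Name → M.C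
  | mk a _ _ _ => a

def idx : M.Name → Type
  | mk _ s _ _ => s

instance : (x : M.Name) → Countable x.idx
  | mk _ _ h _ => h

def elt : (x : M.Name) → x.idx → M.Name
  | mk _ _ _ e => e

/-- The indices of the actual elements of `x`: those whose constants are provably elements. -/
def El (x : M.Name) (k : x.idx) : Prop := M.HoldsMem (x.elt k).val x.val

theorem elt_induction {P : M.Name → Prop} (h : ∀ x, (∀ k, P (x.elt k)) → P x) (x : M.Name) :
    P x := by
  induction x with
  | mk a s _ e ih => exact h _ ih

/-- Extensional equality of names. -/
def Eqv : M.Name → M.Name → Prop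
  | mk a _ _ e, mk b _ _ d => M.HoldsEq a b ∧
      (∀ k, M.HoldsMem (e k).val a →
        ∃ l, M.HoldsMem (d l).val b ∧ Eqv (e k) (d l)) ∧
      (∀ l, M.HoldsMem (d l).val b →
        ∃ k, M.HoldsMem (e k).val a ∧ Eqv (e k) (d l))

theorem eqv_iff {x y : M.Name} : x.Eqv y ↔ M.HoldsEq x.val y.val ∧
    (∀ k, x.El k → ∃ l, y.El l ∧ (x.elt k).Eqv (y.elt l)) ∧
    (∀ l, y.El l → ∃ k, x.El k ∧ (x.elt k).Eqv (y.elt l)) := by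
  cases x; cases y; rw [Eqv]; rfl

theorem Eqv.refl (x : M.Name) : x.Eqv x := by
  induction x using elt_induction with
  | h x ih => exact eqv_iff.2 ⟨.refl _, fun k hk => ⟨k, hk, ih k⟩, fun k hk => ⟨k, hk, ih k⟩⟩

theorem Eqv.symm {x y : M.Name} (h : x.Eqv y) : y.Eqv x := by
  induction x using elt_induction generalizing y with
  | h x ih =>
    obtain ⟨h₁, h₂, h₃⟩ := eqv_iff.1 h
    refine eqv_iff.2 ⟨h₁.symm, fun l hl => ?_, fun k hk => ?_⟩
    · obtain ⟨k, hk, hkl⟩ := h₃ l hl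
      exact ⟨k, hk, ih k hkl⟩
    · obtain ⟨l, hl, hkl⟩ := h₂ k hk
      exact ⟨l, hl, ih k hkl⟩

theorem Eqv.trans {x y z : M.Name} (h : x.Eqv y) (h' : y.Eqv z) : x.Eqv z := by
  induction x using elt_induction generalizing y z with
  | h x ih =>
    obtain ⟨h₁, h₂, h₃⟩ := eqv_iff.1 h
    obtain ⟨h₁', h₂', h₃'⟩ := eqv_iff.1 h'
    refine eqv_iff.2 ⟨h₁.trans h₁', fun k hk => ?_, fun j hj => ?_⟩
    · obtain ⟨l, hl, hkl⟩ := h₂ k hk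
      obtain ⟨j, hj, hlj⟩ := h₂' l hl
      exact ⟨j, hj, ih k hkl hlj⟩
    · obtain ⟨l, hl, hlj⟩ := h₃' j hj
      obtain ⟨k, hk, hkl⟩ := h₃ l hl
      exact ⟨k, hk, ih k hkl hlj⟩

/-- Membership of names. -/
def Mem (z x : M.Name) : Prop := ∃ k, x.El k ∧ z.Eqv (x.elt k)

theorem El.mem {x : M.Name} {k : x.idx} (h : x.El k) : (x.elt k).Mem x := ⟨k, h, .refl _⟩

theorem Eqv.holdsEq {x y : M.Name} (h : x.Eqv y) : M.HoldsEq x.val y.val := (eqv_iff.1 h).1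

theorem Mem.holdsMem {x y : M.Name} (h : x.Mem y) : M.HoldsMem x.val y.val := by
  obtain ⟨k, hk, he⟩ := h
  exact he.holdsEq.symm.mem_left hk

theorem Eqv.mem_left {x y z : M.Name} (h : x.Eqv y) (hm : x.Mem z) : y.Mem z := by
  obtain ⟨k, hk, he⟩ := hm
  exact ⟨k, hk, h.symm.trans he⟩

theorem Eqv.mem_right {x y z : M.Name} (h : x.Eqv y) (hm : z.Mem x) : z.Mem y := by
  obtain ⟨k, hk, he⟩ := hm
  obtain ⟨l, hl, hkl⟩ := (eqv_iff.1 h).2.1 k hk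
  exact ⟨l, hl, he.trans hkl⟩

theorem Eqv.of_mem_iff {x y : M.Name} (h : M.HoldsEq x.val y.val)
    (hm : ∀ z, Mem z x ↔ Mem z y) : x.Eqv y := by
  refine eqv_iff.2 ⟨h, fun k hk => (hm _).1 hk.mem, fun l hl => ?_⟩
  obtain ⟨k, hk, he⟩ := (hm _).2 hl.mem
  exact ⟨k, hk, he.symm⟩

end Name

/-- The Aczel slash over the names: truth of `φ` together with provability. -/
def Slash (M : HenkinTheory T) : {n : ℕ} → SetFormula n → (Fin n → M.Name) → Prop
  | _, falsum, _ => False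
  | _, mem i j, v => (v i).Mem (v j)
  | _, eq i j, v => (v i).Eqv (v j)
  | _, imp φ ψ, v => M.Holds (imp φ ψ) (Name.val ∘ v) ∧ (M.Slash φ v → M.Slash ψ v)
  | _, conj φ ψ, v => M.Slash φ v ∧ M.Slash ψ v
  | _, disj φ ψ, v => M.Slash φ v ∨ M.Slash ψ v
  | _, all φ, v => M.Holds (all φ) (Name.val ∘ v) ∧ ∀ x, M.Slash φ (extend x v)
  | _, ex φ, v => ∃ x, M.Slash φ (extend x v)

/-- The provability conjuncts at `imp` and `all` are there for this; the remaining cases follow from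
the introduction rules and from names carrying provable equality and membership. -/
theorem Slash.holds {n : ℕ} {φ : SetFormula n} {v : Fin n → M.Name} (h : M.Slash φ v) :
    M.Holds φ (Name.val ∘ v) := by
  induction φ with
  | falsum => exact h.elim
  | mem i j => exact holds_mem.2 (Name.Mem.holdsMem h)
  | eq i j => exact holds_eq.2 (Name.Eqv.holdsEq h)
  | imp φ ψ _ _ => exact h.1
  | conj φ ψ ih₁ ih₂ => exact (ih₁ h.1).conj (ih₂ h.2)
  | disj φ ψ ih₁ ih₂ => exact h.elim (fun h => (ih₁ h).inl _) (fun h => (ih₂ h).inr _)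
  | all φ _ => exact h.1
  | ex φ ih =>
    obtain ⟨x, hx⟩ := h
    exact .ex (comp_extend Name.val x v ▸ ih hx)

theorem slash_rename {m n : ℕ} (g : Fin m → Fin n) (φ : SetFormula m) (v : Fin n → M.Name) :
    M.Slash (rename g φ) v ↔ M.Slash φ (v ∘ g) := by
  induction φ generalizing n with
  | falsum => rfl
  | mem i j => rfl
  | eq i j => rfl
  | imp φ ψ ih₁ ih₂ =>
    simp only [rename, Slash, ih₁, ih₂]
    rw [← rename, M.holds_rename]; rfl
  | conj φ ψ ih₁ ih₂ => simp only [rename, Slash, ih₁, ih₂]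
  | disj φ ψ ih₁ ih₂ => simp only [rename, Slash, ih₁, ih₂]
  | all φ ih =>
    simp only [rename, Slash, ih, extend_comp_liftVar]
    rw [← rename, M.holds_rename]; rfl
  | ex φ ih => simp only [rename, Slash, ih, extend_comp_liftVar]

theorem extend_update {α : Type*} {n : ℕ} (z : α) (v : Fin n → α) (i : Fin n) (x : α) :
    extend z (Function.update v i x) = Function.update (extend z v) i.succ x := by
  funext j
  cases j using Fin.cases with
  | zero => simp [Function.update, (Fin.succ_ne_zero i).symm]
  | succ j => simp [Function.update_apply]

theorem Slash.update {n : ℕ} {φ : SetFormula n} {v : Fin n → M.Name} {i : Fin n} {x y : M.Name}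
    (hxy : x.Eqv y) (h : M.Slash φ (Function.update v i x)) :
    M.Slash φ (Function.update v i y) := by
  have upd {n : ℕ} {v : Fin n → M.Name} {i : Fin n} {x y : M.Name} (hxy : x.Eqv y) (j : Fin n) :
      (Function.update v i x j).Eqv (Function.update v i y j) := by
    rcases _root_.eq_or_ne j i with rfl | hj
    · simpa using hxy
    · simpa [hj] using Name.Eqv.refl _
  have hold {n : ℕ} {φ : SetFormula n} {v : Fin n → M.Name} {i : Fin n} {x y : M.Name}
      (hxy : x.Eqv y) (h : M.Holds φ (Name.val ∘ Function.update v i x)) :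
      M.Holds φ (Name.val ∘ Function.update v i y) := by
    rw [Function.comp_update] at h ⊢
    exact hxy.holdsEq.update h
  induction φ generalizing x y with
  | falsum => exact h
  | mem j k => exact (upd hxy k).mem_right ((upd hxy j).mem_left h)
  | eq j k => exact (upd hxy j).symm.trans (h.trans (upd hxy k))
  | imp φ ψ ih₁ ih₂ => exact ⟨hold hxy h.1, fun h' => ih₂ hxy (h.2 (ih₁ hxy.symm h'))⟩
  | conj φ ψ ih₁ ih₂ => exact ⟨ih₁ hxy h.1, ih₂ hxy h.2⟩
  | disj φ ψ ih₁ ih₂ => exact h.imp (ih₁ hxy) (ih₂ hxy)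
  | all φ ih =>
    refine ⟨hold hxy h.1, fun z => ?_⟩
    have := h.2 z
    rw [extend_update] at this ⊢
    exact ih hxy this
  | ex φ ih =>
    obtain ⟨z, hz⟩ := h
    refine ⟨z, ?_⟩
    rw [extend_update] at hz ⊢
    exact ih hxy hz

theorem Slash.subst {n : ℕ} {φ : SetFormula (n + 1)} {v : Fin n → M.Name} {x y : M.Name}
    (h : M.Slash φ (extend x v)) (hxy : x.Eqv y) : M.Slash φ (extend y v) := by
  have (z : M.Name) : extend z v = Function.update (extend x v) 0 z := by
    funext j
    cases j using Fin.cases <;> simp [Function.update]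
  rw [this] at h ⊢
  exact h.update hxy

theorem slash_weaken {n : ℕ} {φ : SetFormula n} {v : Fin n → M.Name} {x : M.Name} :
    M.Slash (weaken φ) (extend x v) ↔ M.Slash φ v :=
  slash_rename _ _ _

theorem slash_inst {n : ℕ} {φ : SetFormula (n + 1)} {v : Fin n → M.Name} {i : Fin n} :
    M.Slash (inst φ i) v ↔ M.Slash φ (extend (v i) v) := by
  rw [inst, slash_rename]
  exact iff_of_eq (congrArg _ (comp_extend v i id))

/-- Soundness of intuitionistic logic for the slash. -/
theorem slash_of_derives (hT : ∀ σ ∈ T, M.Slash σ Fin.elim0) {n : ℕ} {Γ : List (SetFormula n)}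
    {φ : SetFormula n} (h : IntDerives T Γ φ) (v : Fin n → M.Name) (hΓ : ∀ γ ∈ Γ, M.Slash γ v) :
    M.Slash φ v := by
  have wk {n : ℕ} {Γ : List (SetFormula n)} {v : Fin n → M.Name} (hΓ : ∀ γ ∈ Γ, M.Slash γ v)
      (x : M.Name) : ∀ γ ∈ Γ.map weaken, M.Slash γ (extend x v) := by
    simpa [slash_weaken] using hΓ
  -- This supplies the provability conjunct for `impI` and `allI`.
  have hd := fun {n : ℕ} {Γ : List (SetFormula n)} {φ : SetFormula n} (h : IntDerives T Γ φ)
    (v : Fin n → M.Name) (hΓ : ∀ γ ∈ Γ, M.Slash γ v) =>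
      M.holds_of_derives h _ fun γ hγ => (hΓ γ hγ).holds
  induction h with
  | @ax n Γ σ hσ =>
    rw [ofSentence, slash_rename, Subsingleton.elim (v ∘ _) Fin.elim0]
    exact hT σ hσ
  | hyp hφ => exact hΓ _ hφ
  | falsumE _ ih => exact (ih v hΓ).elim
  | andI _ _ ih₁ ih₂ => exact ⟨ih₁ v hΓ, ih₂ v hΓ⟩
  | andE₁ _ ih => exact (ih v hΓ).1
  | andE₂ _ ih => exact (ih v hΓ).2
  | orI₁ _ ih => exact .inl (ih v hΓ)
  | orI₂ _ ih => exact .inr (ih v hΓ)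
  | orE _ _ _ ih ih₁ ih₂ =>
    rcases ih v hΓ with h | h
    · exact ih₁ v (List.forall_mem_cons.2 ⟨h, hΓ⟩)
    · exact ih₂ v (List.forall_mem_cons.2 ⟨h, hΓ⟩)
  | impI h ih => exact ⟨hd (.impI h) v hΓ, fun h => ih v (List.forall_mem_cons.2 ⟨h, hΓ⟩)⟩
  | impE _ _ ih₁ ih₂ => exact (ih₁ v hΓ).2 (ih₂ v hΓ)
  | allI h ih => exact ⟨hd (.allI h) v hΓ, fun x => ih _ (wk hΓ x)⟩
  | allE i _ ih => exact slash_inst.2 ((ih v hΓ).2 (v i))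
  | exI i _ ih => exact ⟨v i, slash_inst.1 (ih v hΓ)⟩
  | exE _ _ ih₁ ih₂ =>
    obtain ⟨x, hx⟩ := ih₁ v hΓ
    exact slash_weaken.1 (ih₂ (extend x v) (List.forall_mem_cons.2 ⟨hx, wk hΓ x⟩))
  | eqRefl i => exact Name.Eqv.refl _
  | eqSubst φ _ _ ih₁ ih₂ =>
    exact slash_inst.2 ((slash_inst.1 (ih₂ v hΓ)).subst (ih₁ v hΓ))

end HenkinTheory

/-! ### Slashing the axioms of IKP. -/

theorem IntDerives.allE_weaken {T : Set SetSentence} {n : ℕ} {Γ : List (SetFormula (n + 1))}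
    {φ : SetFormula (n + 1)} (h : weaken (all φ) ∈ Γ) : IntDerives T Γ φ := by
  have : IntDerives T Γ (inst (rename (liftVar Fin.succ) φ) 0) := .allE 0 (.hyp h)
  rwa [inst_rename_liftVar_succ] at this

namespace HenkinTheory

section

variable {T : Set SetSentence} {M : HenkinTheory T}

/-- This and its companions below pass provability of the whole formula on to its parts, so that for
an axiom mostly its truth over the names is left to check. -/
theorem slash_all_of {n : ℕ} {φ : SetFormula (n + 1)} {v : Fin n → M.Name}
    (h : M.Holds (all φ) (Name.val ∘ v))
    (hφ : ∀ x, M.Holds φ (Name.val ∘ extend x v) → M.Slash φ (extend x v)) :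
    M.Slash (all φ) v :=
  ⟨h, fun x => hφ x (by rw [comp_extend]; exact h.all _)⟩

theorem slash_imp_of {n : ℕ} {φ ψ : SetFormula n} {v : Fin n → M.Name}
    (h : M.Holds (imp φ ψ) (Name.val ∘ v))
    (hψ : M.Slash φ v → M.Holds ψ (Name.val ∘ v) → M.Slash ψ v) : M.Slash (imp φ ψ) v :=
  ⟨h, fun hφ => hψ hφ (h.mp hφ.holds)⟩

theorem slash_iff_of {n : ℕ} {φ ψ : SetFormula n} {v : Fin n → M.Name}
    (h : M.Holds (iff φ ψ) (Name.val ∘ v)) (hψ : M.Slash φ v ↔ M.Slash ψ v) :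
    M.Slash (iff φ ψ) v :=
  ⟨⟨h.left, hψ.1⟩, ⟨h.right, hψ.2⟩⟩

theorem slash_ballIn_of {n : ℕ} {i : Fin n} {φ : SetFormula (n + 1)} {v : Fin n → M.Name}
    (h : M.Holds (ballIn i φ) (Name.val ∘ v))
    (hφ : ∀ k, (v i).El k → M.Holds φ (Name.val ∘ extend ((v i).elt k) v) →
      M.Slash φ (extend ((v i).elt k) v)) : M.Slash (ballIn i φ) v :=
  slash_all_of h fun _ hx => slash_imp_of hx fun ⟨k, hk, hxk⟩ _ =>
    Slash.subst (hφ k hk (by rw [comp_extend]; exact (h.all _).mp (holds_mem.2 hk))) hxk.symm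

theorem slash_bexIn_of {n : ℕ} {i : Fin n} {φ : SetFormula (n + 1)} {v : Fin n → M.Name}
    {x : M.Name} (hx : x.Mem (v i)) (h : M.Slash φ (extend x v)) : M.Slash (bexIn i φ) v :=
  ⟨x, hx, h⟩

theorem slash_univClosure_of {v₀ : Fin 0 → M.Name} : ∀ {n : ℕ} {φ : SetFormula n},
    M.Holds (univClosure φ) (Name.val ∘ v₀) →
      (∀ v : Fin n → M.Name, M.Holds φ (Name.val ∘ v) → M.Slash φ v) →
        M.Slash (univClosure φ) v₀
  | 0, _, h, hφ => hφ _ h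
  | _ + 1, φ, h, hφ => slash_univClosure_of (φ := all φ) h fun v hv =>
      slash_all_of hv fun x => hφ (extend x v)

theorem Holds.univClosure {f₀ : Fin 0 → M.C} : ∀ {n : ℕ} {φ : SetFormula n},
    M.Holds (univClosure φ) f₀ → ∀ f : Fin n → M.C, M.Holds φ f
  | 0, _, h, f => Subsingleton.elim f₀ f ▸ h
  | n + 1, φ, h, f => by
    have := (Holds.univClosure (φ := SetFormula.all φ) h (f ∘ Fin.succ)).all (f 0)
    convert this using 1
    funext i
    cases i using Fin.cases <;> rfl

end

open IKP

variable {M : HenkinTheory IKP.theory}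

theorem holds_of_isAxiom {σ : SetSentence} (h : IsAxiom σ) (f : Fin 0 → M.C) : M.Holds σ f :=
  M.holds_of_derives (Δ := []) (ofSentence_zero σ ▸ IntDerives.ax h) _ (by simp)

/-- `∀ w (w ∈ c → w ∈ u)`, with `u` the variable `0` and `c` the variable `1`. -/
def subsetFormula : SetFormula 2 := all (imp (mem 0 2) (mem 0 1))

/-- Take `u = ⋃ {c, {b}}`, which is `c ∪ {b}`. -/
theorem exists_superset (b c : M.C) : ∃ u, M.HoldsMem b u ∧
    M.Holds subsetFormula (extend u (extend c Fin.elim0)) := by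
  have hp (x y : M.C) := M.witness _ _ (((holds_of_isAxiom .pairing Fin.elim0).all x).all y)
  obtain ⟨p, hp₁⟩ := hp b b
  obtain ⟨q, hq⟩ := hp c p
  obtain ⟨u, hu⟩ := M.witness _ _ ((holds_of_isAxiom .union Fin.elim0).all q)
  have hbp : M.HoldsMem b p :=
    holds_mem.1 ((hp₁.all b).iff.2 (.inl _ (holds_eq.2 (.refl _))))
  have hpq : M.HoldsMem p q :=
    holds_mem.1 ((hq.all p).iff.2 (.inr _ (holds_eq.2 (.refl _))))
  have hcq : M.HoldsMem c q :=
    holds_mem.1 ((hq.all c).iff.2 (.inl _ (holds_eq.2 (.refl _))))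
  refine ⟨u, holds_mem.1 ((hu.all b).iff.2 (.ex (c := p)
    (.conj (holds_mem.2 hbp) (holds_mem.2 hpq)))), ?_⟩
  have hd : IntDerives IKP.theory
      [mem 2 1, all (iff (mem 0 1) (ex (conj (mem 1 0) (mem 0 3))))]
      (rename (extend (0 : Fin 3) (extend 2 Fin.elim0)) subsetFormula) := by
    refine .allI (.impI (.impE (φ := ex (conj (mem 1 0) (mem 0 3))) (.andE₂ (φ := imp (mem 0 1)
      (ex (conj (mem 1 0) (mem 0 3)))) (.allE_weaken (φ := iff (mem 0 1)
        (ex (conj (mem 1 0) (mem 0 3)))) ?_)) (.exI 3 ?_)))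
    · exact List.mem_cons_of_mem _ (List.mem_cons_of_mem _ List.mem_cons_self)
    · exact .andI (.hyp List.mem_cons_self)
        (.hyp (List.mem_cons_of_mem _ List.mem_cons_self))
  have := M.holds_of_derives hd (extend u (extend q (extend c Fin.elim0))) (by
    simp only [List.mem_cons, List.not_mem_nil, or_false]
    rintro δ (rfl | rfl)
    · exact holds_mem.2 hcq
    · exact (M.holds_rename (extend 0 (extend 1 Fin.elim0)) (all (iff (mem 0 1)
        (ex (conj (mem 1 0) (mem 0 3))))) (extend u (extend q (extend c Fin.elim0)))).2 (by
        rw [comp_extend, comp_extend, Subsingleton.elim (_ ∘ Fin.elim0) Fin.elim0]; exact hu))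
  rw [M.holds_rename, comp_extend, comp_extend, Subsingleton.elim (_ ∘ Fin.elim0) Fin.elim0] at this
  exact this

/-- The conclusion `∀ x ∈ w ∃ y ∈ w' φ(x, y, p)` of collection, with `w'` the variable `0` and
`w` the variable `1`. -/
def collectingFormula {n : ℕ} (φ : SetFormula (n + 2)) : SetFormula (n + 2) :=
  ballIn 1 (bexIn 1 (rename (liftVar (liftVar fun i => i.succ.succ)) φ))

/-- The collecting set occurs only as the bound of a positive existential quantifier, so it may be
enlarged. -/
theorem holds_collectingFormula_of_subset {n : ℕ} {φ : SetFormula (n + 2)} {f : Fin n → M.C}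
    {a c u : M.C} (h : M.Holds (collectingFormula φ) (extend c (extend a f)))
    (hu : M.Holds subsetFormula (extend u (extend c Fin.elim0))) :
    M.Holds (collectingFormula φ) (extend u (extend a f)) := by
  -- In the context `u, c, a, f`, the renaming `s i` takes variable `i` as collecting set and `a` as
  -- the set collected over.
  let s (i : Fin (n + 3)) : Fin (n + 2) → Fin (n + 3) :=
    extend i (extend (Fin.succ (Fin.succ 0)) fun j => j.succ.succ.succ)
  have hd : IntDerives IKP.theory
      [rename (s 1) (collectingFormula φ), rename (extend 0 (extend 1 Fin.elim0)) subsetFormula]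
      (rename (s 0) (collectingFormula φ)) := by
    let φ' : SetFormula (n + 5) :=
      rename (liftVar (liftVar fun i => i.succ.succ.succ)) φ
    have hs (i : Fin (n + 3)) : rename (s i) (collectingFormula φ) =
        all (imp (mem 0 3) (ex (conj (mem 0 i.succ.succ) φ'))) := by
      simp only [collectingFormula, ballIn, bexIn, rename, rename_rename, φ', liftVar_comp]
      rfl
    rw [hs, hs]
    refine .allI (.impI (.exE (φ := conj (mem 0 3) φ') (.impE (φ := mem 0 3)
      (.allE_weaken (List.mem_cons_of_mem _ List.mem_cons_self)) (.hyp List.mem_cons_self))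
      (.exI 0 ?_)))
    rw [inst_rename_liftVar_succ]
    have hyp₁ := IntDerives.hyp (T := IKP.theory) (φ := conj (mem 0 3) φ') (Γ := conj (mem 0 3) φ' ::
      List.map weaken (mem 0 3 :: List.map weaken
        [all (imp (mem 0 3) (ex (conj (mem 0 3) φ'))), all (imp (mem 0 2) (mem 0 1))]))
      List.mem_cons_self
    refine .andI (.impE (φ := mem 0 3) (.allE_weaken ?_) hyp₁.andE₁) hyp₁.andE₂
    exact List.mem_cons_of_mem _ (List.mem_cons_of_mem _ (List.mem_cons_of_mem _
      List.mem_cons_self))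
  have := M.holds_of_derives hd (extend u (extend c (extend a f))) (by
    simp only [List.mem_cons, List.not_mem_nil, or_false]
    rintro δ (rfl | rfl)
    · rw [M.holds_rename, comp_extend, comp_extend]; exact h
    · rw [M.holds_rename, comp_extend, comp_extend, Subsingleton.elim (_ ∘ Fin.elim0) Fin.elim0]
      exact hu)
  rw [M.holds_rename, comp_extend, comp_extend] at this
  exact this

/-- In a saturated theory, sets obtained by collection can be taken to contain countably many
given constants. -/
theorem exists_collecting (hM : M.IsSaturated) {n : ℕ} {φ : SetFormula (n + 2)}
    (hφ : IsDelta0 φ) (f : Fin n → M.C) (a : M.C) (h : M.Holds (all (ex φ)) f)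
    {ι : Type} [Countable ι] (b : ι → M.C) :
    ∃ c, M.Holds (collectingFormula φ) (extend c (extend a f)) ∧ ∀ i, M.HoldsMem (b i) c := by
  have h0 := M.witness _ _
    ((((holds_of_isAxiom (.collection φ hφ) Fin.elim0).univClosure f).mp h).all a)
  rcases isEmpty_or_nonempty ι with hι | hι
  · obtain ⟨c, hc⟩ := h0
    exact ⟨c, hc, isEmptyElim⟩
  · obtain ⟨e, he⟩ := exists_surjective_nat ι
    obtain ⟨c, hc, hb⟩ := hM (collectingFormula φ) (extend a f) (b ∘ e) (fun k => by
      induction k with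
      | zero =>
        obtain ⟨c, hc⟩ := h0
        exact ⟨c, hc, by simp⟩
      | succ k ih =>
        obtain ⟨c, hc, hb⟩ := ih
        obtain ⟨u, hbu, hu⟩ := exists_superset (b (e k)) c
        refine ⟨u, holds_collectingFormula_of_subset hc hu, fun l hl => ?_⟩
        rcases Nat.lt_succ_iff_lt_or_eq.1 hl with hl | rfl
        · exact holds_mem.1 ((hu.all (b (e l))).mp (holds_mem.2 (hb l hl)))
        · exact hbu)
    refine ⟨c, hc, fun i => ?_⟩
    obtain ⟨k, rfl⟩ := he i
    exact hb k

/-- Agreement of elements gives only the set-theoretic half of `Eqv`; equality of the values comes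
from the slashed premise being provable. -/
theorem slash_extensionality : M.Slash extensionality Fin.elim0 :=
  slash_all_of (holds_of_isAxiom .extensionality _) fun _ hx => slash_all_of hx fun _ hy =>
    slash_imp_of hy fun h hE => .of_mem_iff (holds_eq.1 hE) fun z => ⟨(h.2 z).1.2, (h.2 z).2.2⟩

theorem slash_emptySet : M.Slash emptySet Fin.elim0 := by
  obtain ⟨c, hc⟩ := M.witness _ _ (holds_of_isAxiom .emptySet (Name.val ∘ Fin.elim0))
  let x : M.Name := .mk c Empty inferInstance Empty.elim
  refine ⟨x, slash_all_of (by rw [comp_extend]; exact hc) fun u hu => ?_⟩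
  refine slash_imp_of hu fun ⟨k, _⟩ _ => ?_
  exact k.elim

theorem slash_pairing : M.Slash pairing Fin.elim0 := by
  refine slash_all_of (holds_of_isAxiom .pairing _) fun x hx => slash_all_of hx fun y hy => ?_
  obtain ⟨c, hc⟩ := M.witness _ _ hy
  let z : M.Name := .mk c Bool inferInstance fun k => bif k then x else y
  have hz : M.Holds (all (iff (mem 0 1) (disj (eq 0 3) (eq 0 2))))
    (Name.val ∘ extend z (extend y (extend x Fin.elim0))) := by rw [comp_extend]; exact hc
  have hEl : ∀ k, z.El k := by
    intro k
    cases k with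
    | true => exact holds_mem.1 ((hc.all x.val).iff.2 (.inl _ (holds_eq.2 (.refl _))))
    | false => exact holds_mem.1 ((hc.all y.val).iff.2 (.inr _ (holds_eq.2 (.refl _))))
  refine ⟨z, slash_all_of hz fun w hw => slash_iff_of hw ⟨?_, ?_⟩⟩
  · rintro ⟨k, _, hk⟩
    cases k with
    | true => exact .inl hk
    | false => exact .inr hk
  · rintro (h | h)
    · exact ⟨true, hEl true, h⟩
    · exact ⟨false, hEl false, h⟩

theorem slash_union : M.Slash union Fin.elim0 := by
  refine slash_all_of (holds_of_isAxiom .union _) fun x hx => ?_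
  obtain ⟨c, hc⟩ := M.witness _ _ hx
  let y : M.Name := .mk c {p : Σ k : x.idx, (x.elt k).idx // x.El p.1 ∧ (x.elt p.1).El p.2} inferInstance
    fun p => (x.elt p.1.1).elt p.1.2
  have hy : M.Holds (all (iff (mem 0 1) (ex (conj (mem 1 0) (mem 0 3)))))
    (Name.val ∘ extend y (extend x Fin.elim0)) := by rw [comp_extend]; exact hc
  refine ⟨y, slash_all_of hy fun w hw => slash_iff_of hw ⟨fun h => ?_, ?_⟩⟩
  · obtain ⟨⟨⟨k, l⟩, hk, hl⟩, _, hwl⟩ := h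
    exact ⟨x.elt k, ⟨l, hl, hwl⟩, hk.mem⟩
  · rintro ⟨z, hwz, k, hk, hzk⟩
    obtain ⟨l, hl, hwl⟩ := hzk.mem_right hwz
    exact ⟨⟨⟨k, l⟩, hk, hl⟩, holds_mem.1 ((hc.all _).iff.2 (.ex (c := (x.elt k).val)
      (.conj (holds_mem.2 hl) (holds_mem.2 hk)))), hwl⟩

end HenkinTheory

/-! ### Induction, separation, collection and infinity. -/

namespace HenkinTheory

section

variable {T : Set SetSentence} {M : HenkinTheory T}

theorem slash_isEmpty_iff {n : ℕ} {i : Fin n} {v : Fin n → M.Name} :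
    M.Slash (isEmpty i) v ↔ M.Slash (isEmpty 0) (extend (v i) Fin.elim0) := by
  rw [show isEmpty i = rename (extend i Fin.elim0) (isEmpty 0) from rfl, slash_rename,
    comp_extend, Subsingleton.elim (v ∘ Fin.elim0) Fin.elim0]

theorem slash_isSucc_iff {n : ℕ} {i j : Fin n} {v : Fin n → M.Name} :
    M.Slash (isSucc i j) v ↔
      M.Slash (isSucc 1 0) (extend (v j) (extend (v i) Fin.elim0)) := by
  rw [show isSucc i j = rename (extend j (extend i Fin.elim0)) (isSucc 1 0) from rfl,
    slash_rename, comp_extend, comp_extend, Subsingleton.elim (v ∘ Fin.elim0) Fin.elim0]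

end

open IKP

variable {M : HenkinTheory IKP.theory}

/-- Truth is proved by well-founded induction on names. The provability conjunct of the bounded
premise follows from `hall`, the already provable conclusion. -/
theorem slash_induction {n : ℕ} (φ : SetFormula (n + 1)) :
    M.Slash (induction φ) Fin.elim0 := by
  refine slash_univClosure_of (holds_of_isAxiom (.induction φ) _) fun v hv =>
    slash_imp_of hv fun hstep hall => slash_all_of hall fun x hx => ?_
  clear hx
  induction x using Name.elt_induction with
  | h x ih =>
    refine (hstep.2 x).2 (slash_ballIn_of ?_ fun k _ _ => (slash_rename _ _ _).2 ?_)
    · refine M.holds_of_derives (Δ := [weaken (all φ)]) (.allI (.impI (.allE_weaken ?_))) _ ?_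
      · exact List.mem_cons_of_mem _ List.mem_cons_self
      · simp only [List.mem_singleton, forall_eq]
        exact (M.holds_rename _ _ _).2 hall
    · rw [extend_comp_liftVar]
      exact ih k

theorem slash_separation {n : ℕ} {φ : SetFormula (n + 1)} (hφ : IsDelta0 φ) :
    M.Slash (separation φ) Fin.elim0 := by
  refine slash_univClosure_of (holds_of_isAxiom (.separation φ hφ) _) fun v hv =>
    slash_all_of hv fun x hx => ?_
  obtain ⟨c, hc⟩ := M.witness _ _ hx
  -- The elements are selected by slash truth, decided in the metatheory; since truth entails
  -- provability, `c` provably contains them.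
  let z : M.Name := .mk c {k : x.idx // x.El k ∧ M.Slash φ (extend (x.elt k) v)} inferInstance
    fun k => x.elt k
  refine ⟨z, slash_all_of (by rw [comp_extend]; exact hc) fun w hw => slash_iff_of hw ⟨?_, ?_⟩⟩
  · rintro ⟨⟨k, hk, hφk⟩, _, hwk⟩
    refine ⟨⟨k, hk, hwk⟩, (slash_rename _ _ _).2 ?_⟩
    rw [extend_comp_liftVar]
    exact hφk.subst hwk.symm
  · rintro ⟨⟨k, hk, hwk⟩, hφw⟩
    have hφk : M.Slash φ (extend (x.elt k) v) := by
      have := (slash_rename _ _ _).1 hφw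
      rw [extend_comp_liftVar] at this
      exact this.subst hwk
    refine ⟨⟨k, hk, hφk⟩, holds_mem.1 ((hc.all _).iff.2 (.conj (holds_mem.2 hk) ?_)), hwk⟩
    rw [M.holds_rename, extend_comp_liftVar]
    have := hφk.holds
    rw [comp_extend] at this
    exact this

/-- Slash truth of the premise gives one witness for each index of `w`, a countable family;
saturation provides a collecting constant containing all their values. -/
theorem slash_collection (hM : M.IsSaturated) {n : ℕ} {φ : SetFormula (n + 2)}
    (hφ : IsDelta0 φ) : M.Slash (collection φ) Fin.elim0 := by
  refine slash_univClosure_of (holds_of_isAxiom (.collection φ hφ) _) fun v hv =>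
    slash_imp_of hv fun hex hall => slash_all_of hall fun w _ => ?_
  choose y hy using fun k : {k // w.El k} => hex.2 (w.elt k)
  obtain ⟨c, hc, hb⟩ := exists_collecting hM hφ _ w.val hex.holds fun k => (y k).val
  refine ⟨.mk c {k // w.El k} inferInstance y, slash_ballIn_of ?_ fun k hk _ =>
    slash_bexIn_of (x := y ⟨k, hk⟩) ⟨⟨k, hk⟩, hb ⟨k, hk⟩, .refl _⟩ ?_⟩
  · rw [comp_extend, comp_extend]
    exact hc
  · rw [slash_rename, extend_comp_liftVar, extend_comp_liftVar]
    exact hy ⟨k, hk⟩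

theorem slash_infinity : M.Slash infinity Fin.elim0 := by
  obtain ⟨c, hc⟩ := M.witness _ _ (holds_of_isAxiom .infinity (Name.val ∘ Fin.elim0))
  obtain ⟨e, he⟩ := M.witness _ _ hc.left
  -- Candidates for numerals: the value lies provably in `c`, and no index is spurious, so that
  -- every entry is inherited by the successor.
  let Pre : Type 1 := {x : M.Name // M.HoldsMem x.val c ∧ ∀ k, x.El k}
  have hzero : ∃ x : Pre, M.Slash (isEmpty 0) (extend x.1 Fin.elim0) := by
    refine ⟨⟨.mk e Empty inferInstance Empty.elim, holds_mem.1 he.left, fun k => k.elim⟩,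
      slash_all_of ?_ fun u hu => slash_imp_of hu fun ⟨k, _⟩ _ => k.elim⟩
    convert (M.holds_rename (extend 0 Fin.elim0) (isEmpty 0) _).1 he.right using 1
    · rfl
    · funext j; fin_cases j; rfl
  have hsucc (x : Pre) : ∃ y : Pre, (x.1.Mem y.1) ∧
      M.Slash (isSucc 1 0) (extend y.1 (extend x.1 Fin.elim0)) := by
    obtain ⟨x, hxc, hx⟩ := x
    obtain ⟨a, ha⟩ := M.witness _ _ ((hc.right.left.all x.val).mp (holds_mem.2 hxc))
    have hmem (u : M.C) := (ha.right.all u).iff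
    -- The index `none` stands for the new element `x` of `x ∪ {x}`.
    let y : M.Name := .mk a (Option x.idx) inferInstance fun k => k.elim x x.elt
    have hy : ∀ k, y.El k := by
      intro k
      cases k with
      | none => exact holds_mem.1 ((hmem _).2 (.inr _ (holds_eq.2 (.refl _))))
      | some k => exact holds_mem.1 ((hmem _).2 (.inl _ (holds_mem.2 (hx k))))
    refine ⟨⟨y, holds_mem.1 ha.left, hy⟩, ⟨none, hy none, .refl _⟩,
      slash_all_of ?_ fun u hu => slash_iff_of hu ⟨?_, ?_⟩⟩
    · convert (M.holds_rename (extend 0 (extend 1 Fin.elim0)) (isSucc 1 0) _).1 ha.right using 1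
      · rfl
      · funext j; fin_cases j <;> rfl
    · rintro ⟨k, _, hk⟩
      cases k with
      | none => exact .inr hk
      | some k => exact .inl ⟨k, hx k, hk⟩
    · rintro (⟨k, _, hk⟩ | h)
      · exact ⟨some k, hy _, hk⟩
      · exact ⟨none, hy _, h⟩
  obtain ⟨x₀, hx₀⟩ := hzero
  choose S hmemS hS using hsucc
  let num : ℕ → Pre := fun n => n.rec x₀ fun _ => S
  -- The value `c` may have nonstandard elements in `M`, but the name has only the standard numerals
  -- as elements, so the last clause is a case distinction on `n`.
  let ω : M.Name := .mk c ℕ inferInstance fun n => (num n).1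
  have hω (n : ℕ) : (num n).1.Mem ω := ⟨n, (num n).2.1, .refl _⟩
  have hc' : M.Holds (conj (bexIn 0 (isEmpty 0)) (conj (ballIn 0 (bexIn 1 (isSucc 1 0)))
      (ballIn 0 (disj (isEmpty 0) (bexIn 0 (isSucc 0 1))))))
      (Name.val ∘ extend ω Fin.elim0) := by
    rw [comp_extend]; exact hc
  refine ⟨ω, slash_bexIn_of (hω 0) (slash_isEmpty_iff.2 hx₀),
    slash_ballIn_of hc'.right.left fun n _ _ =>
      slash_bexIn_of (hω (Nat.succ n)) (slash_isSucc_iff.2 (hS (num n))),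
    slash_ballIn_of hc'.right.right fun n _ _ => ?_⟩
  cases n with
  | zero => exact .inl (slash_isEmpty_iff.2 hx₀)
  | succ n => exact .inr (slash_bexIn_of (hmemS (num n)) (slash_isSucc_iff.2 (hS (num n))))

theorem slash_of_isAxiom (hM : M.IsSaturated) {σ : SetSentence} (h : IsAxiom σ) :
    M.Slash σ Fin.elim0 := by
  cases h with
  | extensionality => exact slash_extensionality
  | emptySet => exact slash_emptySet
  | pairing => exact slash_pairing
  | union => exact slash_union
  | infinity => exact slash_infinity
  | induction φ => exact slash_induction φ
  | separation φ hφ => exact slash_separation hφ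
  | collection φ hφ => exact slash_collection hM hφ

end HenkinTheory

/-! ### The disjunction property. -/

theorem mainTheorem2 (φ ψ : SetSentence)
    (h : IntProvable IKP.theory (SetFormula.disj φ ψ)) :
    IntProvable IKP.theory φ ∨ IntProvable IKP.theory ψ := by
  let M := (Henkin.theory IKP.theory).reducedPower
  have hM : M.IsSaturated := HenkinTheory.isSaturated_reducedPower _
  have key {σ : SetSentence} (hσ : M.Slash σ Fin.elim0) : IntProvable IKP.theory σ := by
    -- A sentence holding in the reduced power holds at some coordinate, hence in the Henkin
    -- extension, which is conservative because IKP proves an existential sentence.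
    obtain ⟨i, hi⟩ := Filter.Eventually.exists hσ.holds
    have he : IntDerives IKP.theory [] (ex (all (neg (mem 0 1)))) :=
      ofSentence_zero IKP.emptySet ▸ IntDerives.ax IKP.IsAxiom.emptySet
    exact Henkin.provable_of_holds he hi
  exact (HenkinTheory.slash_of_derives (fun _ => HenkinTheory.slash_of_isAxiom hM) h Fin.elim0
    (by simp)).imp key key
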